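/- Let $\mathcal A$ be the universal unital $C^*$-algebra of a contraction, i.e. the completion of the *-algebra of noncommutative *-polynomials $q$ in one variable $x$ in the norm $\|q\|=\sup_S\|q(S)\|$, where $S$ ranges over all contractive operators on Hilbert spaces (equivalently, $\mathcal A=C^*(T,I)$ for any universal contraction $T$). Let $C^*(\mathbb F_2)$ be the full group $C^*$-algebra of the free group on two generators, i.e. the completion of $\mathbb C[\mathbb F_2]$ in the norm $\|a\|=\sup_\pi\|\pi(a)\|$, where $\pi$ ranges over all unitary representations of $\mathbb F_2$ on Hilbert spaces. For unital $C^*$-algebras $A$ and $B$, say that $A$ embeds relatively weakly injectively into $B$ if there are an injective unital *-homomorphism $\iota:A\to B$ and a unital completely positive map $\varphi:B\to\pi_u(A)''$ with $\varphi(\iota(a))=\pi_u(a)$ for all $a\in A$, where $\pi_u:A\to B(\mathcal H_u)$ is the universal representation of $A$ (the direct sum of the GNS representations of all states of $A$) and $\pi_u(A)''$ is the bicommutant of its image. **Theorem.** $\mathcal A$ embeds relatively weakly injectively into $C^*(\mathbb F_2)$, and $C^*(\mathbb F_2)$ embeds relatively weakly injectively into $\mathcal A$. -/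

import Mathlib

open scoped ComplexOrder InnerProductSpace CStarAlgebra

noncomputable section

universe u v

/-! ## The full C⋆-algebra of a monoid with involution -/

/-- The *-algebra `ℂ[M]` of a monoid `M` with involution: finite formal complex combinations of
elements of `M`, with the convolution product and `(∑ c_m m)* = ∑ conj(c_m) m*`. -/
def StarMonoidAlgebra (M : Type u) : Type u := MonoidAlgebra ℂ M

namespace StarMonoidAlgebra

variable {M : Type u} [Monoid M]

instance : Ring (StarMonoidAlgebra M) := inferInstanceAs (Ring (MonoidAlgebra ℂ M))

instance : Algebra ℂ (StarMonoidAlgebra M) := inferInstanceAs (Algebra ℂ (MonoidAlgebra ℂ M))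

/-- The linear extension of a multiplicative map from `M` to an algebra. -/
def lift {B : Type v} [Ring B] [Algebra ℂ B] (f : M →* B) : StarMonoidAlgebra M →ₐ[ℂ] B :=
  MonoidAlgebra.lift ℂ B M f

/-- The element of `ℂ[M]` given by `c` times `m`. -/
def single (m : M) (c : ℂ) : StarMonoidAlgebra M := MonoidAlgebra.single m c

@[simp] lemma lift_single {B : Type v} [Ring B] [Algebra ℂ B] (f : M →* B) (m : M) (c : ℂ) :
    lift f (single m c) = c • f m :=
  MonoidAlgebra.lift_single f m c

lemma single_mul_single (m n : M) (c d : ℂ) :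
    single m c * single n d = single (m * n) (c * d) :=
  MonoidAlgebra.single_mul_single m n c d

lemma smul_single (m : M) (c d : ℂ) : c • single m d = single m (c * d) :=
  MonoidAlgebra.smul_single c m d

@[elab_as_elim]
lemma induction_add {p : StarMonoidAlgebra M → Prop} (a : StarMonoidAlgebra M)
    (h0 : p 0) (hs : ∀ m c, p (single m c)) (ha : ∀ a b, p a → p b → p (a + b)) : p a :=
  MonoidAlgebra.induction_linear (motive := p) a h0 ha hs

variable [StarMul M]

/-- The involution of `ℂ[M]` as an additive map. -/
def starAux : StarMonoidAlgebra M →+ StarMonoidAlgebra M :=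
  MonoidAlgebra.liftNC
    ((MonoidAlgebra.singleAddHom (R := ℂ) (1 : M)).comp (starRingEnd ℂ).toAddMonoidHom)
    (fun m : M => (MonoidAlgebra.single (star m) (1 : ℂ) : MonoidAlgebra ℂ M))

lemma starAux_single (m : M) (c : ℂ) :
    starAux (single m c) = single (star m) (starRingEnd ℂ c) := by
  have : starAux (single m c) =
      (MonoidAlgebra.single (1 : M) (starRingEnd ℂ c) : MonoidAlgebra ℂ M) *
        MonoidAlgebra.single (star m) (1 : ℂ) :=
    MonoidAlgebra.liftNC_single _ _ _ _
  rw [this, MonoidAlgebra.single_mul_single, one_mul, mul_one]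
  rfl

instance : StarRing (StarMonoidAlgebra M) where
  star := starAux
  star_involutive a := by
    refine induction_add a (by simp) (fun m c => ?_) (fun a b ha hb => ?_)
    · simp [starAux_single]
    · rw [map_add, map_add, ha, hb]
  star_add a b := map_add _ _ _
  star_mul a b := by
    change starAux (a * b) = starAux b * starAux a
    refine induction_add a (by simp) (fun m c => ?_) (fun a a' ha ha' => ?_)
    · refine induction_add b (by simp) (fun n d => ?_) (fun b b' hb hb' => ?_)
      · simp [starAux_single, single_mul_single, mul_comm]
      · rw [mul_add, map_add, map_add, hb, hb', add_mul]
    · rw [add_mul, map_add, map_add, ha, ha', mul_add]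

lemma star_single (m : M) (c : ℂ) : star (single m c) = single (star m) (star c) :=
  starAux_single m c

instance : StarModule ℂ (StarMonoidAlgebra M) where
  star_smul c a := by
    refine induction_add a (by simp) (fun m d => ?_) (fun a b ha hb => ?_)
    · simp [smul_single, star_single]
    · rw [smul_add, star_add, star_add, ha, hb, smul_add]

end StarMonoidAlgebra

/-- A *-representation of a monoid with involution by contractions on a complex Hilbert space. -/
structure ContractiveRep (M : Type u) [Monoid M] [StarMul M] where
  /-- the Hilbert space -/
  H : Type u
  [normed : NormedAddCommGroup H]
  [inner : InnerProductSpace ℂ H]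
  [complete : CompleteSpace H]
  /-- the representation -/
  rep : M →⋆* (H →L[ℂ] H)
  norm_le : ∀ m, ‖rep m‖ ≤ 1

attribute [instance] ContractiveRep.normed ContractiveRep.inner ContractiveRep.complete

namespace ContractiveRep

variable {M : Type u} [Monoid M] [StarMul M]

/-- The *-homomorphism `ℂ[M] → B(H)` induced by a *-representation of `M`. -/
def eval (π : ContractiveRep M) : StarMonoidAlgebra M →⋆ₐ[ℂ] (π.H →L[ℂ] π.H) where
  __ := StarMonoidAlgebra.lift π.rep.toMonoidHom
  map_star' a := by
    change StarMonoidAlgebra.lift π.rep.toMonoidHom (star a) =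
      star (StarMonoidAlgebra.lift π.rep.toMonoidHom a)
    refine StarMonoidAlgebra.induction_add a (by simp) (fun m c => ?_) (fun a b ha hb => ?_)
    · rw [StarMonoidAlgebra.star_single, StarMonoidAlgebra.lift_single,
        StarMonoidAlgebra.lift_single, star_smul]
      congr 1
      exact π.rep.map_star' m
    · rw [star_add, map_add, map_add, ha, hb, star_add]

lemma eval_single (π : ContractiveRep M) (m : M) (c : ℂ) :
    π.eval (StarMonoidAlgebra.single m c) = c • π.rep m :=
  StarMonoidAlgebra.lift_single _ m c

lemma bddAbove_eval (a : StarMonoidAlgebra M) :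
    BddAbove (Set.range fun π : ContractiveRep M => ‖π.eval a‖) := by
  refine StarMonoidAlgebra.induction_add a ?_ (fun m c => ?_) (fun a b ha hb => ?_)
  · exact ⟨0, by rintro _ ⟨π, rfl⟩; simp⟩
  · refine ⟨‖c‖, ?_⟩
    rintro _ ⟨π, rfl⟩
    simp only [eval_single]
    rw [norm_smul]
    exact mul_le_of_le_one_right (norm_nonneg _) (π.norm_le m)
  · obtain ⟨C, hC⟩ := ha
    obtain ⟨D, hD⟩ := hb
    refine ⟨C + D, ?_⟩
    rintro _ ⟨π, rfl⟩
    simp only [map_add]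
    exact (norm_add_le _ _).trans (add_le_add (hC ⟨π, rfl⟩) (hD ⟨π, rfl⟩))

end ContractiveRep

namespace StarMonoidAlgebra

variable {M : Type u} [Monoid M] [StarMul M]

/-- The full C⋆-seminorm of `ℂ[M]`: the supremum of `‖π(a)‖` over all contractive
*-representations `π` of `M` on Hilbert spaces. -/
def fullNorm (a : StarMonoidAlgebra M) : ℝ := ⨆ π : ContractiveRep M, ‖π.eval a‖

lemma eval_le_fullNorm (π : ContractiveRep M) (a : StarMonoidAlgebra M) :
    ‖π.eval a‖ ≤ fullNorm a :=
  le_ciSup (ContractiveRep.bddAbove_eval a) π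

lemma fullNorm_nonneg (a : StarMonoidAlgebra M) : 0 ≤ fullNorm a :=
  Real.iSup_nonneg fun _ => norm_nonneg _

lemma fullNorm_le {a : StarMonoidAlgebra M} {C : ℝ} (hC : 0 ≤ C)
    (h : ∀ π : ContractiveRep M, ‖π.eval a‖ ≤ C) : fullNorm a ≤ C :=
  Real.iSup_le h hC

/-- The full C⋆-seminorm as a seminorm of the additive group of `ℂ[M]`. -/
def fullSeminorm : AddGroupSeminorm (StarMonoidAlgebra M) where
  toFun := fullNorm
  map_zero' := by simp [fullNorm]
  add_le' a b := fullNorm_le (add_nonneg (fullNorm_nonneg a) (fullNorm_nonneg b)) fun π => by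
    rw [map_add]
    exact (norm_add_le _ _).trans (add_le_add (eval_le_fullNorm π a) (eval_le_fullNorm π b))
  neg' a := by simp [fullNorm]

/-- `ℂ[M]` is normed by the full C⋆-seminorm. -/
instance : SeminormedRing (StarMonoidAlgebra M) where
  __ := (inferInstance : Ring (StarMonoidAlgebra M))
  __ := (fullSeminorm (M := M)).toSeminormedAddCommGroup
  norm_mul_le a b := fullNorm_le (mul_nonneg (fullNorm_nonneg a) (fullNorm_nonneg b)) fun π => by
    rw [map_mul]
    exact (norm_mul_le _ _).trans
      (mul_le_mul (eval_le_fullNorm π a) (eval_le_fullNorm π b) (norm_nonneg _)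
        (fullNorm_nonneg a))

lemma norm_def (a : StarMonoidAlgebra M) : ‖a‖ = ⨆ π : ContractiveRep M, ‖π.eval a‖ := rfl

lemma norm_eval_le (π : ContractiveRep M) (a : StarMonoidAlgebra M) : ‖π.eval a‖ ≤ ‖a‖ :=
  eval_le_fullNorm π a

lemma norm_le_of_eval {a : StarMonoidAlgebra M} {C : ℝ} (hC : 0 ≤ C)
    (h : ∀ π : ContractiveRep M, ‖π.eval a‖ ≤ C) : ‖a‖ ≤ C :=
  fullNorm_le hC h

instance : NormedAlgebra ℂ (StarMonoidAlgebra M) where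
  norm_smul_le c a := norm_le_of_eval (mul_nonneg (norm_nonneg c) (norm_nonneg a)) fun π => by
    rw [map_smul, norm_smul]
    exact mul_le_mul_of_nonneg_left (norm_eval_le π a) (norm_nonneg c)

instance : NormedStarGroup (StarMonoidAlgebra M) where
  norm_star_le a := norm_le_of_eval (norm_nonneg a) fun π => by
    rw [map_star, norm_star]
    exact norm_eval_le π a

lemma norm_mul_self_le (a : StarMonoidAlgebra M) : ‖a‖ * ‖a‖ ≤ ‖star a * a‖ := by
  have h : ‖a‖ ≤ Real.sqrt ‖star a * a‖ := norm_le_of_eval (Real.sqrt_nonneg _) fun π => by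
    refine Real.le_sqrt_of_sq_le ?_
    rw [sq, ← CStarRing.norm_star_mul_self, ← map_star, ← map_mul]
    exact norm_eval_le π _
  calc ‖a‖ * ‖a‖ ≤ Real.sqrt ‖star a * a‖ * Real.sqrt ‖star a * a‖ :=
        mul_self_le_mul_self (norm_nonneg a) h
    _ = ‖star a * a‖ := Real.mul_self_sqrt (norm_nonneg _)

end StarMonoidAlgebra

/-- The full C⋆-algebra of a monoid `M` with involution: the (Hausdorff) completion of `ℂ[M]` in
the full C⋆-seminorm. It is the universal unital C⋆-algebra for *-representations of `M` by
contractions. -/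
def FullCStarAlgebra (M : Type u) [Monoid M] [StarMul M] : Type u :=
  UniformSpace.Completion (StarMonoidAlgebra M)

namespace FullCStarAlgebra

open UniformSpace

variable {M : Type u} [Monoid M] [StarMul M]

instance : NormedRing (FullCStarAlgebra M) :=
  inferInstanceAs (NormedRing (Completion (StarMonoidAlgebra M)))

instance : CompleteSpace (FullCStarAlgebra M) :=
  inferInstanceAs (CompleteSpace (Completion (StarMonoidAlgebra M)))

instance : Algebra ℂ (FullCStarAlgebra M) :=
  inferInstanceAs (Algebra ℂ (Completion (StarMonoidAlgebra M)))

instance : NormedAlgebra ℂ (FullCStarAlgebra M) where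
  norm_smul_le c a := norm_smul_le (β := Completion (StarMonoidAlgebra M)) c a

/-- The canonical map from `ℂ[M]` to its completion. -/
def of (a : StarMonoidAlgebra M) : FullCStarAlgebra M := (a : Completion (StarMonoidAlgebra M))

lemma star_uniformContinuous :
    UniformContinuous (star : StarMonoidAlgebra M → StarMonoidAlgebra M) :=
  (starₗᵢ ℂ : StarMonoidAlgebra M ≃ₗᵢ⋆[ℂ] StarMonoidAlgebra M).isometry.uniformContinuous

/-- The involution of the completion: the continuous extension of that of `ℂ[M]`. -/
instance : Star (FullCStarAlgebra M) where
  star := Completion.map (star : StarMonoidAlgebra M → StarMonoidAlgebra M)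

lemma star_of (a : StarMonoidAlgebra M) : star (of a) = of (star a) :=
  Completion.map_coe star_uniformContinuous a

lemma continuous_star' : Continuous (star : FullCStarAlgebra M → FullCStarAlgebra M) :=
  Completion.continuous_map

lemma of_add (a b : StarMonoidAlgebra M) : of (a + b) = of a + of b :=
  Completion.coe_add a b

lemma of_mul (a b : StarMonoidAlgebra M) : of (a * b) = of a * of b :=
  Completion.coe_mul a b

lemma of_smul (c : ℂ) (a : StarMonoidAlgebra M) : of (c • a) = c • of a :=
  Completion.coe_smul c a

lemma norm_of (a : StarMonoidAlgebra M) : ‖of a‖ = ‖a‖ :=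
  Completion.norm_coe a

lemma denseRange_of : DenseRange (of : StarMonoidAlgebra M → FullCStarAlgebra M) :=
  Completion.denseRange_coe

instance : StarRing (FullCStarAlgebra M) where
  star_involutive a := by
    refine denseRange_of.induction_on (p := fun a => star (star a) = a) a
      (isClosed_eq (continuous_star'.comp continuous_star') continuous_id) fun a => ?_
    rw [star_of, star_of, star_star]
  star_add a b := by
    refine denseRange_of.induction_on₂ (p := fun a b => star (a + b) = star a + star b)
      (isClosed_eq (continuous_star'.comp (continuous_fst.add continuous_snd))
        ((continuous_star'.comp continuous_fst).add (continuous_star'.comp continuous_snd)))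
      (fun a b => ?_) a b
    rw [star_of, star_of, ← of_add, ← of_add, star_of, star_add]
  star_mul a b := by
    refine denseRange_of.induction_on₂ (p := fun a b => star (a * b) = star b * star a)
      (isClosed_eq (continuous_star'.comp (continuous_fst.mul continuous_snd))
        ((continuous_star'.comp continuous_snd).mul (continuous_star'.comp continuous_fst)))
      (fun a b => ?_) a b
    rw [star_of, star_of, ← of_mul, ← of_mul, star_of, star_mul]

instance : StarModule ℂ (FullCStarAlgebra M) where
  star_smul c a := by
    refine denseRange_of.induction_on (p := fun a => star (c • a) = star c • star a) a
      (isClosed_eq (continuous_star'.comp (continuous_const_smul c))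
        (continuous_star'.const_smul (star c))) fun a => ?_
    rw [star_of, ← of_smul, ← of_smul, star_of, star_smul]

instance : CStarRing (FullCStarAlgebra M) where
  norm_mul_self_le a := by
    refine denseRange_of.induction_on (p := fun a => ‖a‖ * ‖a‖ ≤ ‖star a * a‖) a
      (isClosed_le (continuous_norm.mul continuous_norm)
        (continuous_star'.mul continuous_id).norm) fun a => ?_
    rw [star_of, ← of_mul, norm_of, norm_of]
    exact StarMonoidAlgebra.norm_mul_self_le a

instance : CStarAlgebra (FullCStarAlgebra M) where

/-- The usual order of a C⋆-algebra: `a ≤ b` when `b - a` is self-adjoint with spectrum in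
`[0, ∞)`. -/
instance : PartialOrder (FullCStarAlgebra M) := CStarAlgebra.spectralOrder _

instance : StarOrderedRing (FullCStarAlgebra M) := CStarAlgebra.spectralOrderedRing _

end FullCStarAlgebra

/-! ## The two algebras -/

/-- A group, regarded as a monoid with involution `g* = g⁻¹`. Its *-representations are the
unitary representations of the group. -/
def StarGroup (G : Type u) : Type u := G

instance (G : Type u) [Group G] : Group (StarGroup G) := inferInstanceAs (Group G)

instance (G : Type u) [Group G] : StarMul (StarGroup G) where
  star g := g⁻¹
  star_involutive := inv_inv
  star_mul := mul_inv_rev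

/-- The full group C⋆-algebra `C*(G)` of a discrete group. -/
abbrev GroupCStarAlgebra (G : Type u) [Group G] : Type u := FullCStarAlgebra (StarGroup G)

/-- The free monoid with involution on one generator `x`: words in the letters `x` (`false`) and
`x*` (`true`). Its complex *-algebra is the algebra of noncommutative *-polynomials in `x`, and its
contractive *-representations are given by arbitrary contractions, the images of `x`. -/
def StarWord : Type := FreeMonoid Bool

instance : Monoid StarWord := inferInstanceAs (Monoid (FreeMonoid Bool))

/-- The involution reverses a word and exchanges `x` and `x*`. -/
instance : StarMul StarWord where
  star w := FreeMonoid.ofList ((FreeMonoid.toList w).reverse.map not)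
  star_involutive w := by
    change FreeMonoid.ofList (((FreeMonoid.toList w).reverse.map not).reverse.map not) = w
    simp [← List.map_reverse, Function.comp_def]
    rfl
  star_mul v w := by
    change FreeMonoid.ofList ((FreeMonoid.toList v ++ FreeMonoid.toList w).reverse.map not) = _
    rw [List.reverse_append, List.map_append]
    rfl

/-- The universal unital C⋆-algebra of a contraction. -/
abbrev UniversalContractionAlgebra : Type := FullCStarAlgebra StarWord

/-! ## The universal representation and relative weak injectivity -/

section UniversalRepresentation

variable (A : Type u) [CStarAlgebra A] [PartialOrder A] [StarOrderedRing A]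

/-- The states of a unital C⋆-algebra: the unital positive linear functionals. -/
def StateSpace : Type u := {φ : A →ₚ[ℂ] ℂ // φ 1 = 1}

/-- The Hilbert space of the universal representation: the Hilbert sum of the GNS spaces of all
states. -/
abbrev UniversalHilbert : Type u := lp (fun φ : StateSpace A => φ.1.GNS) 2

/-- The universal representation of a unital C⋆-algebra: the direct sum of the GNS
representations of all its states. -/
def universalRep : A →⋆ₐ[ℂ] (UniversalHilbert A →L[ℂ] UniversalHilbert A) where
  toFun a := lp.mapCLM 2 (fun φ : StateSpace A => φ.1.gnsStarAlgHom a) (norm_nonneg a)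
    (fun φ => NonUnitalStarAlgHom.norm_apply_le φ.1.gnsStarAlgHom a)
  map_one' := by ext; simp
  map_mul' a b := by ext; simp
  map_zero' := by ext; simp
  map_add' a b := by ext; simp
  commutes' c := by
    ext x φ
    simp [Algebra.algebraMap_eq_smul_one]
  map_star' a := by
    refine (ContinuousLinearMap.eq_adjoint_iff _ _).2 fun x y => ?_
    rw [lp.inner_eq_tsum, lp.inner_eq_tsum]
    refine tsum_congr fun φ => ?_
    change ⟪φ.1.gnsStarAlgHom (star a) (x φ), y φ⟫_ℂ = ⟪x φ, φ.1.gnsStarAlgHom a (y φ)⟫_ℂ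
    rw [map_star, ContinuousLinearMap.star_eq_adjoint, ContinuousLinearMap.adjoint_inner_left]

end UniversalRepresentation

/-- `A` embeds relatively weakly injectively into `B`: there are an injective unital
*-homomorphism `ι : A → B` and a weak expectation for it, that is, a unital completely positive
map `φ : B → π_u(A)''` with `φ ∘ ι = π_u`, where `π_u` is the universal representation of `A`. -/
def EmbedsRWI (A : Type u) (B : Type v)
    [CStarAlgebra A] [PartialOrder A] [StarOrderedRing A]
    [CStarAlgebra B] [PartialOrder B] [StarOrderedRing B] : Prop :=
  ∃ ι : A →⋆ₐ[ℂ] B, Function.Injective ι ∧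
    ∃ φ : B →CP (UniversalHilbert A →L[ℂ] UniversalHilbert A),
      φ 1 = 1 ∧
      (∀ b : B, φ b ∈ Set.centralizer (Set.centralizer (Set.range (universalRep A)))) ∧
      ∀ a : A, φ (ι a) = universalRep A a

end

/-! Both weak expectations can be chosen to be *-homomorphisms. Write `π_u` for the universal
representation of the algebra being embedded, and `δ₀, δ₁` for the canonical unitaries of `C*(F₂)`.

From `𝒜` into `C*(F₂)`: the generator `x` equals `c((u + u*) + i(v + v*))` for unitaries `u, v` of
`𝒜`. Sending `δ₀, δ₁` to `u, v` defines `q : C*(F₂) → 𝒜` with `x` in its image. Since `x` lifts to a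
contraction (`StarAlgHom.exists_norm_le_one_map_eq`), the universal property of `𝒜` splits `q`. Thus
`𝒜` is a retract of `C*(F₂)`, and `π_u ∘ q` is a weak expectation.

From `C*(F₂)` into `𝒜`: the unitaries `π_u(δ_j)` have self-adjoint logarithms `h_j` in
`π_u(C*(F₂))''` (`exists_selfAdjoint_expUnitary_eq`). Let `q` send `x` to the contraction `C⁻¹(h₀ +
i h₁)`; its range stays in that bicommutant. The real and imaginary parts of `Cx` are mapped to `h₀,
h₁`, so their exponential unitaries lift `π_u(δ_j)` to `𝒜`. The resulting `ι : C*(F₂) → 𝒜` satisfies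
`q ∘ ι = π_u`.

In each case `ι` is injective because `π_u` is faithful. -/

open scoped ComplexOrder InnerProductSpace CStarAlgebra

noncomputable section

/-! ### States and faithfulness of the universal representation. -/

section States

open scoped ComplexStarModule

variable {A : Type u} [CStarAlgebra A] [PartialOrder A] [StarOrderedRing A]

/-- A real functional on a C⋆-algebra that is nonnegative on positive elements gives a complex
positive functional with the same values on self-adjoint elements. -/
def PositiveLinearMap.ofReal (f : A →ₗ[ℝ] ℝ) (hf : ∀ a, 0 ≤ a → 0 ≤ f a) : A →ₚ[ℂ] ℂ :=
  PositiveLinearMap.mk₀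
    { toFun := fun a => (f (ℜ a : A) : ℂ) + Complex.I * (f (ℑ a : A) : ℂ)
      map_add' := fun a b => by simp [mul_add, add_add_add_comm]
      map_smul' := fun c a => by
        rw [realPart_smul, imaginaryPart_smul]
        apply Complex.ext <;> simp }
    fun a ha => by
      have h : IsSelfAdjoint a := ha.isSelfAdjoint
      simpa [h.coe_realPart, h.imaginaryPart] using hf a ha

lemma PositiveLinearMap.ofReal_apply (f : A →ₗ[ℝ] ℝ) (hf : ∀ a, 0 ≤ a → 0 ≤ f a) {a : A}
    (ha : IsSelfAdjoint a) : PositiveLinearMap.ofReal f hf a = f a := by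
  change (f (ℜ a : A) : ℂ) + Complex.I * (f (ℑ a : A) : ℂ) = f a
  simp [ha.coe_realPart, ha.imaginaryPart]

/-- Positive functionals separate the positive elements of a C⋆-algebra from `0`. -/
lemma exists_positive_apply_pos {a : A} (ha : 0 ≤ a) (ha0 : a ≠ 0) :
    ∃ f : A →ₗ[ℝ] ℝ, (∀ b, 0 ≤ b → 0 ≤ f b) ∧ 0 < f a := by
  have hmem : -a ∉ ProperCone.positive ℝ A := by
    rw [ProperCone.mem_positive, neg_nonneg]
    exact fun h => ha0 (le_antisymm h ha)
  obtain ⟨f, hf, hfa⟩ := ProperCone.hyperplane_separation_point _ hmem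
  exact ⟨f, fun b hb => hf b hb, by simpa using hfa⟩

/-- States separate the positive elements of a C⋆-algebra from `0`. -/
lemma exists_state_apply_ne_zero {a : A} (ha : 0 ≤ a) (ha0 : a ≠ 0) :
    ∃ φ : StateSpace A, φ.1 a ≠ 0 := by
  obtain ⟨f, hf, hfa⟩ := exists_positive_apply_pos ha ha0
  -- Positivity of `f 1`, needed to normalise `f` to a state: `a ≤ ‖a‖ • 1` gives `0 < f a ≤ ‖a‖ f
  -- 1`.
  have h1 : 0 < f 1 := by
    have hle : a ≤ ‖a‖ • (1 : A) := by
      simpa [Algebra.algebraMap_eq_smul_one] using ha.isSelfAdjoint.le_algebraMap_norm_self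
    have : 0 ≤ f (‖a‖ • (1 : A) - a) := hf _ (sub_nonneg.2 hle)
    rw [map_sub, map_smul, smul_eq_mul] at this
    exact pos_of_mul_pos_right (hfa.trans_le (sub_nonneg.1 this)) (norm_nonneg a)
  have hg : ∀ b, 0 ≤ b → 0 ≤ ((f 1)⁻¹ • f) b := fun b hb =>
    mul_nonneg (inv_nonneg.2 h1.le) (hf b hb)
  refine ⟨⟨PositiveLinearMap.ofReal ((f 1)⁻¹ • f) hg, ?_⟩, ?_⟩
  · rw [PositiveLinearMap.ofReal_apply _ _ (IsSelfAdjoint.one A)]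
    simp [h1.ne']
  · rw [PositiveLinearMap.ofReal_apply _ _ ha.isSelfAdjoint]
    simp [h1.ne', hfa.ne']

lemma universalRep_apply (a : A) (x : UniversalHilbert A) (φ : StateSpace A) :
    universalRep A a x φ = φ.1.gnsStarAlgHom a (x φ) := rfl

variable (A) in
/-- The universal representation is faithful. -/
lemma universalRep_injective : Function.Injective (universalRep A) := by
  classical
  refine (injective_iff_map_eq_zero _).2 fun a ha => ?_
  by_contra ha0
  obtain ⟨φ, hφ⟩ := exists_state_apply_ne_zero (star_mul_self_nonneg a)
    (by simpa using ha0)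
  -- Applied to the cyclic vector of `φ`, the operator of `a` gives the class of `a`, whose squared
  -- norm is `φ (star a * a)`.
  have h : φ.1.gnsStarAlgHom a ((φ.1.toPreGNS 1 : φ.1.PreGNS) : φ.1.GNS) = 0 := by
    have := congr($ha (lp.single 2 φ ((φ.1.toPreGNS 1 : φ.1.PreGNS) : φ.1.GNS)) φ)
    rw [universalRep_apply] at this
    simpa using this
  rw [PositiveLinearMap.gnsStarAlgHom_apply] at h
  have h2 : ‖φ.1.toPreGNS a‖ = 0 := by
    rw [← UniformSpace.Completion.norm_coe]
    have h' : ((φ.1.toPreGNS a : φ.1.PreGNS) : φ.1.GNS) = 0 := by simpa using h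
    rw [h', norm_zero]
  apply hφ
  have := φ.1.preGNS_norm_sq (φ.1.toPreGNS a)
  simpa [h2] using this.symm

end States

/-! ### Universal property of the full C⋆-algebra. -/

namespace FullCStarAlgebra

open StarMonoidAlgebra

variable {M : Type u} [Monoid M] [StarMul M]

/-- The canonical unitary or contraction in the full C⋆-algebra of `M` given by `m : M`. -/
def gen (m : M) : FullCStarAlgebra M := of (single m 1)

@[elab_as_elim]
lemma induction_closed {p : FullCStarAlgebra M → Prop} (a : FullCStarAlgebra M)
    (hc : IsClosed {a | p a}) (hs : ∀ (m : M) (c : ℂ), p (c • gen m))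
    (ha : ∀ a b, p a → p b → p (a + b)) : p a := by
  refine denseRange_of.induction_on a hc fun a => ?_
  have hs' : ∀ (m : M) (c : ℂ), p (of (single m c)) := fun m c => by
    have := hs m c
    rwa [gen, ← of_smul, smul_single, mul_one] at this
  refine StarMonoidAlgebra.induction_add a ?_ hs' fun a b h h' => ?_
  · have := hs' 1 0
    rwa [show single (1 : M) (0 : ℂ) = 0 from MonoidAlgebra.single_zero _] at this
  · rw [of_add]
    exact ha _ _ h h'

lemma gen_one : gen (1 : M) = 1 := rfl

lemma gen_mul (m n : M) : gen (m * n) = gen m * gen n := by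
  rw [gen, gen, gen, ← of_mul, single_mul_single, one_mul]

lemma star_gen (m : M) : star (gen m) = gen (star m) := by
  rw [gen, gen, star_of, star_single, star_one]

lemma norm_gen_le (m : M) : ‖gen m‖ ≤ 1 := by
  rw [gen, norm_of]
  refine norm_le_of_eval zero_le_one fun π => ?_
  rw [ContractiveRep.eval_single, one_smul]
  exact π.norm_le m

/-- The generators as a monoid homomorphism. -/
def genHom : M →* FullCStarAlgebra M where
  toFun := gen
  map_one' := gen_one
  map_mul' := gen_mul

variable {B : Type v} [CStarAlgebra B]

lemma algHom_ext {f g : FullCStarAlgebra M →⋆ₐ[ℂ] B} (h : ∀ m, f (gen m) = g (gen m)) :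
    f = g := by
  ext a
  refine induction_closed a ?_ (fun m c => ?_) fun a b ha hb => ?_
  · exact isClosed_eq (map_continuous f) (map_continuous g)
  · rw [map_smul, map_smul, h]
  · rw [map_add, map_add, ha, hb]

end FullCStarAlgebra

namespace StarMonoidAlgebra

variable {M : Type u} [Monoid M] [StarMul M] {B : Type u} [CStarAlgebra B]

/-- A contractive *-homomorphism from `M` to a C⋆-algebra is contractive on `ℂ[M]`. -/
lemma norm_lift_le (f : M →⋆* B) (hf : ∀ m, ‖f m‖ ≤ 1) (a : StarMonoidAlgebra M) :
    ‖lift f.toMonoidHom a‖ ≤ ‖a‖ := by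
  let _ : PartialOrder B := CStarAlgebra.spectralOrder B
  have _ : StarOrderedRing B := CStarAlgebra.spectralOrderedRing B
  -- The full norm only tests operators on Hilbert spaces, so `B` is replaced by its isometric image
  -- under a faithful representation.
  let ρ := universalRep B
  have hρ : ∀ b, ‖ρ b‖ ≤ ‖b‖ := fun b => NonUnitalStarAlgHom.norm_apply_le ρ b
  let π : ContractiveRep M :=
    { H := UniversalHilbert B
      rep :=
        { toMonoidHom := (ρ : B →* _).comp f.toMonoidHom
          map_star' := fun m => (congrArg ρ (map_star f m)).trans (map_star ρ (f m)) }
      norm_le := fun m => (hρ (f m)).trans (hf m) }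
  have key : π.eval a = ρ (lift f.toMonoidHom a) := by
    refine StarMonoidAlgebra.induction_add a (by simp) (fun m c => ?_) fun a b ha hb => ?_
    · rw [ContractiveRep.eval_single, lift_single, map_smul]
      rfl
    · rw [map_add, map_add, map_add, ha, hb]
  rw [← NonUnitalStarAlgHom.norm_map ρ (universalRep_injective B), ← key]
  exact norm_eval_le π a

end StarMonoidAlgebra

namespace FullCStarAlgebra

open StarMonoidAlgebra

variable {M : Type u} [Monoid M] [StarMul M] {B : Type u} [CStarAlgebra B]

/-- The universal property of the full C⋆-algebra. -/
theorem exists_lift (f : M →⋆* B) (hf : ∀ m, ‖f m‖ ≤ 1) :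
    ∃ F : FullCStarAlgebra M →⋆ₐ[ℂ] B, ∀ m, F (gen m) = f m := by
  have hcont : Continuous (lift f.toMonoidHom : StarMonoidAlgebra M →ₐ[ℂ] B) :=
    (AddMonoidHomClass.lipschitz_of_bound (lift f.toMonoidHom) 1
      fun a => by simpa using norm_lift_le f hf a).continuous
  let F₀ : FullCStarAlgebra M →+* B :=
    UniformSpace.Completion.extensionHom
      (lift f.toMonoidHom : StarMonoidAlgebra M →ₐ[ℂ] B).toRingHom hcont
  have hF₀ : ∀ a, F₀ (of a) = lift f.toMonoidHom a := fun a =>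
    UniformSpace.Completion.extensionHom_coe
      (lift f.toMonoidHom : StarMonoidAlgebra M →ₐ[ℂ] B).toRingHom hcont a
  have hF₀c : Continuous F₀ := UniformSpace.Completion.continuous_extension
  have hgen : ∀ m, F₀ (gen m) = f m := fun m => by
    rw [gen, hF₀, lift_single, one_smul]
    rfl
  have hsmul : ∀ (c : ℂ) a, F₀ (c • a) = c • F₀ a := fun c a => by
    refine denseRange_of.induction_on (p := fun a => F₀ (c • a) = c • F₀ a) a
      (isClosed_eq (hF₀c.comp (continuous_const_smul c)) (hF₀c.const_smul c)) fun a => ?_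
    rw [← of_smul, hF₀, hF₀, map_smul]
  have hstar : ∀ a, F₀ (star a) = star (F₀ a) := fun a => by
    refine induction_closed a ?_ (fun m c => ?_) fun a b ha hb => ?_
    · exact isClosed_eq (hF₀c.comp continuous_star) hF₀c.star
    · rw [star_smul, hsmul, hsmul, star_gen, hgen, hgen, star_smul, map_star]
    · rw [star_add, map_add, map_add, ha, hb, star_add]
  exact ⟨{ F₀ with
    commutes' := fun c => by
      change F₀ (algebraMap ℂ _ c) = _
      rw [Algebra.algebraMap_eq_smul_one, hsmul, map_one, Algebra.algebraMap_eq_smul_one]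
    map_star' := hstar }, hgen⟩

end FullCStarAlgebra

/-! ### *-words and the universal contraction. -/

namespace StarWord

open FullCStarAlgebra

/-- The generator `x` of the free monoid with involution. -/
def x : StarWord := FreeMonoid.of false

variable {B : Type v} [Monoid B] [StarMul B]

/-- Evaluation of *-words at an element. -/
def evalHom (b : B) : StarWord →⋆* B where
  toMonoidHom := FreeMonoid.lift fun i : Bool => if i then star b else b
  map_star' w := by
    change FreeMonoid.lift _ (FreeMonoid.ofList ((FreeMonoid.toList w).reverse.map not)) =
      star (FreeMonoid.lift _ w)
    refine FreeMonoid.recOn w (by simp) fun i w ih => ?_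
    rw [FreeMonoid.toList_of_mul, List.reverse_cons, List.map_append, FreeMonoid.ofList_append,
      map_mul, map_mul, star_mul, ih]
    congr 1
    cases i <;> simp

lemma evalHom_x (b : B) : evalHom b x = b := by
  change FreeMonoid.lift _ (FreeMonoid.of false) = b
  simp

@[elab_as_elim]
lemma induction {p : StarWord → Prop} (w : StarWord) (h1 : p 1) (hx : p x) (hx' : p (star x))
    (hm : ∀ v w, p v → p w → p (v * w)) : p w := by
  refine FreeMonoid.recOn (motive := p) w h1 fun i w ih => hm _ _ ?_ ih
  cases i
  · exact hx
  · exact hx'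

end StarWord

/-- The universal property of the universal C⋆-algebra of a contraction. -/
theorem UniversalContractionAlgebra.exists_lift {B : Type} [CStarAlgebra B] {b : B}
    (hb : ‖b‖ ≤ 1) :
    ∃ F : UniversalContractionAlgebra →⋆ₐ[ℂ] B, F (FullCStarAlgebra.gen StarWord.x) = b := by
  -- The empty word goes to `1`, which has norm `1` only when `B` is nontrivial.
  obtain _ | _ := subsingleton_or_nontrivial B
  · obtain ⟨F, -⟩ := FullCStarAlgebra.exists_lift (StarWord.evalHom b)
      fun m => by simp [Subsingleton.elim (StarWord.evalHom b m) 0]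
    exact ⟨F, Subsingleton.elim _ _⟩
  obtain ⟨F, hF⟩ := FullCStarAlgebra.exists_lift (StarWord.evalHom b) fun m => by
    refine StarWord.induction m (by simp) ?_ ?_ fun v w hv hw => ?_
    · rwa [StarWord.evalHom_x]
    · rwa [map_star, norm_star, StarWord.evalHom_x]
    · rw [map_mul]
      exact (norm_mul_le _ _).trans (mul_le_one₀ hv (norm_nonneg _) hw)
  exact ⟨F, by rw [hF, StarWord.evalHom_x]⟩

@[ext]
lemma UniversalContractionAlgebra.algHom_ext {B : Type v} [CStarAlgebra B]
    {f g : UniversalContractionAlgebra →⋆ₐ[ℂ] B}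
    (h : f (FullCStarAlgebra.gen StarWord.x) = g (FullCStarAlgebra.gen StarWord.x)) : f = g := by
  refine FullCStarAlgebra.algHom_ext fun m => ?_
  refine StarWord.induction m ?_ h ?_ fun v w hv hw => ?_
  · rw [FullCStarAlgebra.gen_one, map_one, map_one]
  · rw [← FullCStarAlgebra.star_gen, map_star, map_star, h]
  · rw [FullCStarAlgebra.gen_mul, map_mul, map_mul, hv, hw]

/-! ### Universal property of the group C⋆-algebra. -/

namespace GroupCStarAlgebra

open FullCStarAlgebra

variable {G : Type u} [Group G]

lemma gen_mem_unitary (g : StarGroup G) : gen g ∈ unitary (GroupCStarAlgebra G) := by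
  constructor
  · rw [star_gen, ← gen_mul]
    exact congrArg gen (inv_mul_cancel g)
  · rw [star_gen, ← gen_mul]
    exact congrArg gen (mul_inv_cancel g)

/-- The canonical unitary given by a group element. -/
def unit (g : G) : unitary (GroupCStarAlgebra G) :=
  ⟨gen (M := StarGroup G) g, gen_mem_unitary g⟩

/-- The universal property of the full group C⋆-algebra. -/
theorem exists_lift {B : Type u} [CStarAlgebra B] (f : G →* unitary B) :
    ∃ F : GroupCStarAlgebra G →⋆ₐ[ℂ] B, ∀ g, F (unit g) = f g := by
  let f' : StarGroup G →⋆* B :=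
    { toFun := fun g : G => (f g : B)
      map_one' := congrArg Subtype.val (map_one f)
      map_mul' := fun g h => congrArg Subtype.val (map_mul f g h)
      map_star' := fun g => congrArg Subtype.val (map_inv f g) }
  exact FullCStarAlgebra.exists_lift f' fun g => by
    obtain _ | _ := subsingleton_or_nontrivial B
    · simp [Subsingleton.elim (f' g) 0]
    · exact (CStarRing.norm_coe_unitary (f g)).le

lemma algHom_ext_freeGroup {α : Type u} {B : Type v} [CStarAlgebra B]
    {f g : GroupCStarAlgebra (FreeGroup α) →⋆ₐ[ℂ] B}
    (h : ∀ i : α, f (unit (G := FreeGroup α) (.of i)) = g (unit (G := FreeGroup α) (.of i))) : f = g := by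
  have key : ((f : _ →* B).comp (genHom (M := StarGroup (FreeGroup α))) : FreeGroup α →* B) =
      (g : _ →* B).comp (genHom (M := StarGroup (FreeGroup α))) :=
    FreeGroup.ext_hom _ _ h
  exact FullCStarAlgebra.algHom_ext fun m => DFunLike.congr_fun key m

end GroupCStarAlgebra

/-! ### Logarithms of unitaries inside the generated von Neumann algebra. -/

section Exponential

/-- The exponential only depends on the part of an element that is cut down by a commuting
element. -/
lemma NormedSpace.exp_mul_eq_exp_mul {B : Type v} [NormedRing B] [NormedAlgebra ℂ B]
    [CompleteSpace B] {a b p : B} (h : a * p = b * p) (hb : Commute b p) :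
    NormedSpace.exp a * p = NormedSpace.exp b * p := by
  have hpow : ∀ n : ℕ, a ^ n * p = b ^ n * p := fun n => by
    induction n with
    | zero => rw [pow_zero, pow_zero]
    | succ n ih =>
      rw [pow_succ, mul_assoc, h, hb.eq, ← mul_assoc, ih, mul_assoc, ← hb.eq, ← mul_assoc,
        ← pow_succ]
  have ha := (NormedSpace.exp_series_hasSum_exp' (𝕂 := ℂ) a).mul_right p
  have hb := (NormedSpace.exp_series_hasSum_exp' (𝕂 := ℂ) b).mul_right p
  simp only [smul_mul_assoc, hpow] at ha hb
  exact ha.unique hb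

end Exponential

section Logarithm

section Circle

variable {A : Type v} [CStarAlgebra A] {u : A}

/-- `arccos (Re z)` is continuous on the whole circle, at the price of folding it onto the upper
half: the exponential is `z` or its conjugate according to the sign of `Im z`. -/
lemma Complex.exp_I_mul_arccos {z : ℂ} (hz : ‖z‖ = 1) :
    Complex.exp (Complex.I * (Real.arccos z.re : ℝ)) = z.re + Complex.I * |z.im| := by
  have h : z.re ^ 2 + z.im ^ 2 = 1 := by
    have := Complex.sq_norm z
    rw [hz, Complex.normSq_apply] at this
    linarith
  rw [mul_comm, Complex.exp_mul_I, ← Complex.ofReal_cos, ← Complex.ofReal_sin,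
    Real.cos_arccos (by nlinarith) (by nlinarith), Real.sin_arccos, mul_comm,
    show 1 - z.re ^ 2 = z.im ^ 2 by linarith, Real.sqrt_sq_eq_abs]

lemma exp_smul_cfc_arccos (hu : u ∈ unitary A) (c : ℂ) :
    NormedSpace.exp (c • cfc (fun z : ℂ => ((Real.arccos z.re : ℝ) : ℂ)) u) =
      cfc (fun z : ℂ => Complex.exp (c * (Real.arccos z.re : ℝ))) u := by
  have hn : IsStarNormal u := isStarNormal_of_mem_unitary hu
  have h1 : Continuous fun z : ℂ => c * ((Real.arccos z.re : ℝ) : ℂ) :=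
    continuous_const.mul (Complex.continuous_ofReal.comp
      (Real.continuous_arccos.comp Complex.continuous_re))
  have h2 : Continuous fun z : ℂ => ((Real.arccos z.re : ℝ) : ℂ) :=
    Complex.continuous_ofReal.comp (Real.continuous_arccos.comp Complex.continuous_re)
  rw [← cfc_const_mul c _ u h2.continuousOn, ← CFC.exp_eq_normedSpace_exp (𝕜 := ℂ),
    ← cfc_comp' _ _ u (NormedSpace.exp_continuous.continuousOn) h1.continuousOn]
  simp only [Complex.exp_eq_exp_ℂ]

/-- On the circle `Re z + i|Im z| = z + 2i (Im z)₋`, so the exponential is correct wherever the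
negative part of `Im u` vanishes. -/
lemma exp_I_smul_cfc_arccos (hu : u ∈ unitary A) :
    NormedSpace.exp (Complex.I • cfc (fun z : ℂ => ((Real.arccos z.re : ℝ) : ℂ)) u) =
      u + (2 * Complex.I) • cfc (fun z : ℂ => ((max (-z.im) 0 : ℝ) : ℂ)) u := by
  have hn : IsStarNormal u := isStarNormal_of_mem_unitary hu
  rw [exp_smul_cfc_arccos hu, ← cfc_const_mul _ _ u]
  nth_rw 2 [← cfc_id' ℂ u]
  rw [← cfc_add u (fun z : ℂ => z) _]
  refine cfc_congr fun z hz => ?_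
  rw [Complex.exp_I_mul_arccos (spectrum.norm_eq_one_of_unitary hu hz)]
  rcases le_total z.im 0 with h | h
  · rw [abs_of_nonpos h, max_eq_left (by linarith)]
    apply Complex.ext <;> simp
    ring
  · rw [abs_of_nonneg h, max_eq_right (by linarith)]
    apply Complex.ext <;> simp

/-- The conjugate of the previous identity: with the opposite angle, the error lives on the positive
part of `Im u`. -/
lemma exp_neg_I_smul_cfc_arccos (hu : u ∈ unitary A) :
    NormedSpace.exp (-(Complex.I • cfc (fun z : ℂ => ((Real.arccos z.re : ℝ) : ℂ)) u)) =
      u - (2 * Complex.I) • cfc (fun z : ℂ => ((max z.im 0 : ℝ) : ℂ)) u := by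
  have hn : IsStarNormal u := isStarNormal_of_mem_unitary hu
  rw [← neg_smul, exp_smul_cfc_arccos hu, ← cfc_const_mul _ _ u]
  nth_rw 2 [← cfc_id' ℂ u]
  rw [← cfc_sub (fun z : ℂ => z) _ u]
  refine cfc_congr fun z hz => ?_
  have hz1 := spectrum.norm_eq_one_of_unitary hu hz
  have key := Complex.exp_I_mul_arccos (z := z) hz1
  have hconj := congrArg (starRingEnd ℂ) key
  rw [← Complex.exp_conj] at hconj
  simp only [map_mul, map_add, Complex.conj_I, Complex.conj_ofReal] at hconj
  rw [hconj]
  rcases le_total z.im 0 with h | h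
  · rw [abs_of_nonpos h, max_eq_right (by linarith)]
    apply Complex.ext <;> simp
  · rw [abs_of_nonneg h, max_eq_left (by linarith)]
    apply Complex.ext <;> simp
    ring

end Circle

variable {H : Type v} [NormedAddCommGroup H] [InnerProductSpace ℂ H] [CompleteSpace H]

/-- The projection onto the kernel of an operator `s` commutes with `y` whenever `s` commutes with
`y` and `y*`. -/
lemma commute_starProjection_ker {s y : H →L[ℂ] H} (h : Commute s y) (h' : Commute s (star y)) :
    Commute (LinearMap.ker s.toLinearMap).starProjection y := by
  set p := (LinearMap.ker s.toLinearMap).starProjection with hp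
  have hsa : IsSelfAdjoint p := isSelfAdjoint_starProjection _
  -- An operator commuting with `s` preserves `ker s`. Applied to `y` and, after taking adjoints, to
  -- `star y`, this makes `ker s` reducing for `y`.
  have inv : ∀ z, Commute s z → p * z * p = z * p := fun z hz => by
    ext v
    refine Submodule.starProjection_eq_self_iff.2 ?_
    have hv : s (p v) = 0 :=
      (Submodule.starProjection_apply_mem (LinearMap.ker s.toLinearMap) v :)
    change s (z (p v)) = 0
    have := congr($(hz.eq) (p v))
    simpa [hv] using this
  have h1 := congrArg star (inv _ h')
  simp only [star_mul, star_star, hsa.star_eq] at h1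
  change p * y = y * p
  exact h1.symm.trans ((mul_assoc _ _ _).symm.trans (inv y h))

/-- Every unitary operator `u` is the exponential `exp(ih)` of a self-adjoint operator `h` in the
von Neumann algebra generated by `u`. -/
theorem exists_selfAdjoint_expUnitary_eq (u : unitary (H →L[ℂ] H)) :
    ∃ h : selfAdjoint (H →L[ℂ] H), selfAdjoint.expUnitary h = u ∧
      ∀ y : H →L[ℂ] H, Commute (u : H →L[ℂ] H) y → Commute (u : H →L[ℂ] H) (star y) →
        Commute (h : H →L[ℂ] H) y := by
  set U : H →L[ℂ] H := (u : H →L[ℂ] H) with hU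
  have hn : IsStarNormal U := inferInstance
  -- the positive and negative parts of `Im u`, and `arccos (Re u)`
  set sp : H →L[ℂ] H := cfc (fun z : ℂ => ((max z.im 0 : ℝ) : ℂ)) U with hsp
  set sm : H →L[ℂ] H := cfc (fun z : ℂ => ((max (-z.im) 0 : ℝ) : ℂ)) U with hsm
  set θ : H →L[ℂ] H := cfc (fun z : ℂ => ((Real.arccos z.re : ℝ) : ℂ)) U with hθ
  set p := (LinearMap.ker sm.toLinearMap).starProjection with hp
  have hcfc : ∀ (f : ℂ → ℂ) (y : H →L[ℂ] H), Commute U y → Commute U (star y) →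
      Commute (cfc f U) y := fun f y h h' =>
    Commute.cfc h (by simpa using (h'.star_star : Commute (star U) (star (star y)))) f
  have hpy : ∀ y : H →L[ℂ] H, Commute U y → Commute U (star y) → Commute p y := fun y h h' =>
    commute_starProjection_ker (hcfc _ y h h') (hcfc _ _ h' (by rwa [star_star]))
  have hpsa : IsSelfAdjoint p := isSelfAdjoint_starProjection _
  have hpp : p * p = p := (Submodule.isIdempotentElem_starProjection _)
  have hθsa : IsSelfAdjoint θ := by
    rw [isSelfAdjoint_iff, hθ, ← cfc_star]
    simp
  have hUU : Commute U (star U) := (star_comm_self' U).symm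
  have hpU : Commute p U := hpy U (Commute.refl U) hUU
  have hpθ : Commute p θ := (hcfc _ p hpU.symm (by rw [hpsa.star_eq]; exact hpU.symm)).symm
  have hsmp : sm * p = 0 := by
    ext v
    exact (Submodule.starProjection_apply_mem (LinearMap.ker sm.toLinearMap) v :)
  have hsmsp : sm * sp = 0 := by
    rw [hsm, hsp, ← cfc_mul _ _ U, ← cfc_zero ℂ U]
    refine cfc_congr fun z _ => ?_
    rcases le_total z.im 0 with h | h
    · simp [h]
    · simp [h]
  -- `sm * sp = 0` puts the range of `sp` inside `ker sm`, the range of `p`.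
  have hpsp : p * sp = sp := by
    ext v
    refine Submodule.starProjection_eq_self_iff.2 ?_
    exact congr($hsmsp v)
  have hspp : sp * p = sp := by
    have : Commute p sp := (hcfc _ p hpU.symm (by rw [hpsa.star_eq]; exact hpU.symm)).symm
    rw [← this.eq, hpsp]
  -- The symmetry `J` is `1` on the range of `p` and `-1` on its complement. The logarithm is `J *
  -- θ`: the angle `θ` where `sm` vanishes, and `-θ` on the complement, where `sp` vanishes. The
  -- projection `p` supplies the discontinuity that continuous functional calculus cannot.
  set J := p - (1 - p) with hJ
  have hJy : ∀ y : H →L[ℂ] H, Commute p y → Commute J y := fun y h =>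
    h.sub_left ((Commute.one_left y).sub_left h)
  have hJθ : Commute J θ := hJy θ hpθ
  have hJsa : IsSelfAdjoint J := hpsa.sub ((IsSelfAdjoint.one _).sub hpsa)
  refine ⟨⟨J * θ, hJsa.commute_iff hθsa |>.1 hJθ⟩, ?_, fun y h h' =>
    (hJy y (hpy y h h')).mul_left (hcfc _ y h h')⟩
  have hplus : NormedSpace.exp (Complex.I • θ) = U + (2 * Complex.I) • sm :=
    exp_I_smul_cfc_arccos u.2
  have hminus : NormedSpace.exp (-(Complex.I • θ)) = U - (2 * Complex.I) • sp :=
    exp_neg_I_smul_cfc_arccos u.2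
  ext1
  rw [selfAdjoint.expUnitary_coe]
  change NormedSpace.exp (Complex.I • (J * θ)) = U
  set E := NormedSpace.exp (Complex.I • (J * θ)) with hE
  have e1 : E * p = U * p := by
    rw [hE, NormedSpace.exp_mul_eq_exp_mul (b := Complex.I • θ) _ (hpθ.symm.smul_left _), hplus,
      add_mul, smul_mul_assoc, hsmp, smul_zero, add_zero]
    rw [smul_mul_assoc, smul_mul_assoc, hJθ.eq, mul_assoc, hJ, sub_mul, sub_mul, hpp, one_mul,
      sub_self, sub_zero]
  have e2 : E * (1 - p) = U * (1 - p) := by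
    rw [hE, NormedSpace.exp_mul_eq_exp_mul (b := -(Complex.I • θ)) _
      (((Commute.one_right _).sub_right hpθ.symm).smul_left _).neg_left, hminus,
      sub_mul, smul_mul_assoc, mul_sub sp, hspp, mul_one, sub_self, smul_zero, sub_zero]
    rw [← smul_neg, smul_mul_assoc, smul_mul_assoc, hJθ.eq, mul_assoc, neg_mul, ← mul_neg]
    congr 2
    rw [hJ, sub_mul, mul_sub, mul_one, hpp, sub_self, mul_sub (1 - p), mul_one, sub_mul 1 p p, hpp,
      one_mul]
    simp
  calc E = E * p + E * (1 - p) := by rw [← mul_add, add_sub_cancel, mul_one]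
    _ = U := by rw [e1, e2, ← mul_add, add_sub_cancel, mul_one]

end Logarithm

/-! ### Lifting contractions, and spanning by unitaries. -/

section Lifting

open scoped ComplexStarModule

variable {A : Type u} {B : Type v} [CStarAlgebra A] [CStarAlgebra B]

lemma StarAlgHom.map_realPart (f : A →⋆ₐ[ℂ] B) (a : A) : f (ℜ a : A) = (ℜ (f a) : B) := by
  rw [realPart_apply_coe, realPart_apply_coe, ← Complex.coe_smul, ← Complex.coe_smul, map_smul,
    map_add, map_star]

lemma StarAlgHom.map_imaginaryPart (f : A →⋆ₐ[ℂ] B) (a : A) : f (ℑ a : A) = (ℑ (f a) : B) := by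
  rw [imaginaryPart_apply_coe, imaginaryPart_apply_coe, ← Complex.coe_smul, ← Complex.coe_smul,
    map_smul, map_smul, map_sub, map_star]

/-- A contraction in the image of a *-homomorphism is the image of a contraction. -/
theorem StarAlgHom.exists_norm_le_one_map_eq (q : B →⋆ₐ[ℂ] A) {x : A} (hx : ‖x‖ ≤ 1) {y : B}
    (hy : q y = x) : ∃ y' : B, ‖y'‖ ≤ 1 ∧ q y' = x := by
  let _ : PartialOrder A := CStarAlgebra.spectralOrder A
  have _ : StarOrderedRing A := CStarAlgebra.spectralOrderedRing A
  let _ : PartialOrder B := CStarAlgebra.spectralOrder B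
  have _ : StarOrderedRing B := CStarAlgebra.spectralOrderedRing B
  -- With `z = y f(y*y)`, the element `z*z` is the function `t / max 1 t ≤ 1` of `y*y`. As `f = 1`
  -- on `[0, 1]`, which contains the spectrum of `x*x`, the correction is invisible after `q`.
  let f : ℝ → ℝ := fun t => (√(max 1 t))⁻¹
  have hpos : ∀ t : ℝ, 0 < √(max 1 t) := fun t => Real.sqrt_pos.2 (by positivity)
  have hf : Continuous f :=
    (Real.continuous_sqrt.comp (continuous_const.max continuous_id)).inv₀ fun t => (hpos t).ne'
  have hsa : IsSelfAdjoint (star y * y) := .star_mul_self y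
  refine ⟨y * cfc f (star y * y), ?_, ?_⟩
  · have h : star (y * cfc f (star y * y)) * (y * cfc f (star y * y)) =
        cfc (fun t => f t * (t * f t)) (star y * y) := by
      rw [cfc_mul f (fun t => t * f t) (star y * y) hf.continuousOn
          (continuous_id.mul hf).continuousOn,
        cfc_mul (fun t : ℝ => t) f (star y * y) continuousOn_id hf.continuousOn,
        cfc_id' ℝ (star y * y), star_mul, (cfc_predicate f (star y * y)).star_eq]
      simp only [mul_assoc]
    have h2 : ‖cfc (fun t => f t * (t * f t)) (star y * y)‖ ≤ 1 := by
      refine norm_cfc_le zero_le_one fun t ht => ?_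
      have ht0 : 0 ≤ t := spectrum_nonneg_of_nonneg (star_mul_self_nonneg y) ht
      have : f t * (t * f t) = t / max 1 t := by
        rw [mul_left_comm, ← mul_inv, Real.mul_self_sqrt (by positivity), div_eq_mul_inv]
      rw [this, Real.norm_of_nonneg (by positivity)]
      exact div_le_one_of_le₀ (le_max_right _ _) (by positivity)
    rw [← h, CStarRing.norm_star_mul_self] at h2
    nlinarith [norm_nonneg (y * cfc f (star y * y))]
  · have hxx : ‖star x * x‖ ≤ 1 := by
      rw [CStarRing.norm_star_mul_self]
      exact mul_le_one₀ hx (norm_nonneg _) hx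
    have h1 : cfc f (star x * x) = 1 := by
      rw [← cfc_one ℝ (star x * x)]
      refine cfc_congr fun t ht => ?_
      obtain _ | _ := subsingleton_or_nontrivial A
      · simp [spectrum.of_subsingleton] at ht
      · have := (le_abs_self t).trans ((spectrum.norm_le_norm_of_mem ht).trans hxx)
        simp [f, max_eq_left this]
    rw [map_mul, StarAlgHomClass.map_cfc q f (star y * y) hf.continuousOn (map_continuous q) hsa
        (hsa.map q),
      map_mul, map_star, hy, h1, mul_one]

/-- Every element of a C⋆-algebra is a multiple of a fixed combination of two unitaries and their
adjoints. -/
lemma CStarAlgebra.exists_eq_smul_two_unitary (x : A) :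
    ∃ (c : ℝ) (u v : unitary A),
      x = c • ((u + star u : A) + Complex.I • (v + star v : A)) := by
  let _ : PartialOrder A := CStarAlgebra.spectralOrder A
  have _ : StarOrderedRing A := CStarAlgebra.spectralOrderedRing A
  obtain rfl | hx := eq_or_ne x 0
  · exact ⟨0, 1, 1, by simp⟩
  · have h := CStarAlgebra.norm_smul_two_inv_smul_add_four_unitary x hx
    extract_lets u v at h
    exact ⟨‖x‖ * 2⁻¹, u, v, by rwa [smul_smul] at h⟩

end Lifting

/-! ### The two embeddings. -/

section Embeddings

open FullCStarAlgebra

/-- A *-homomorphism into `π_u(A)''` extending `π_u` along `ι` is a weak expectation for `ι`. -/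
lemma EmbedsRWI.of_comp_eq {A : Type u} {B : Type v}
    [CStarAlgebra A] [PartialOrder A] [StarOrderedRing A]
    [CStarAlgebra B] [PartialOrder B] [StarOrderedRing B] (ι : A →⋆ₐ[ℂ] B)
    (q : B →⋆ₐ[ℂ] (UniversalHilbert A →L[ℂ] UniversalHilbert A))
    (hq : ∀ b : B, q b ∈ Set.centralizer (Set.centralizer (Set.range (universalRep A))))
    (h : ∀ a, q (ι a) = universalRep A a) : EmbedsRWI A B := by
  refine ⟨ι, fun a b hab => universalRep_injective A ?_,
    CompletelyPositiveMapClass.toCompletelyPositiveLinearMap q, map_one q, hq, h⟩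
  rw [← h, ← h, hab]

lemma universalRep_mem_bicommutant {A : Type u}
    [CStarAlgebra A] [PartialOrder A] [StarOrderedRing A] (a : A) :
    universalRep A a ∈ Set.centralizer (Set.centralizer (Set.range (universalRep A))) :=
  Set.subset_centralizer_centralizer ⟨a, rfl⟩

/-- A retract embeds relatively weakly injectively. -/
lemma EmbedsRWI.of_retract {A : Type u} {B : Type v}
    [CStarAlgebra A] [PartialOrder A] [StarOrderedRing A]
    [CStarAlgebra B] [PartialOrder B] [StarOrderedRing B] (ι : A →⋆ₐ[ℂ] B) (q : B →⋆ₐ[ℂ] A)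
    (h : ∀ a, q (ι a) = a) : EmbedsRWI A B :=
  .of_comp_eq ι ((universalRep A).comp q) (fun _ => universalRep_mem_bicommutant _)
    fun a => congrArg (universalRep A) (h a)

open GroupCStarAlgebra in
theorem embedsRWI_universalContraction_freeGroup :
    EmbedsRWI UniversalContractionAlgebra (GroupCStarAlgebra (FreeGroup (Fin 2))) := by
  obtain ⟨c, u, v, huv⟩ := CStarAlgebra.exists_eq_smul_two_unitary
    (gen StarWord.x : UniversalContractionAlgebra)
  obtain ⟨q, hq⟩ := GroupCStarAlgebra.exists_lift (FreeGroup.lift ![u, v])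
  let δ : Fin 2 → GroupCStarAlgebra (FreeGroup (Fin 2)) := fun i =>
    unit (G := FreeGroup (Fin 2)) (.of i)
  have h0 : q (δ 0) = u := by simp [δ, hq]
  have h1 : q (δ 1) = v := by simp [δ, hq]
  have hy : q ((c : ℂ) • ((δ 0 + star (δ 0)) + Complex.I • (δ 1 + star (δ 1)))) =
      gen StarWord.x := by
    rw [huv, map_smul, map_add, map_smul, map_add, map_add, map_star, map_star, h0, h1,
      Complex.coe_smul, Unitary.coe_star, Unitary.coe_star]
  obtain ⟨y, hy1, hqy⟩ := q.exists_norm_le_one_map_eq (norm_gen_le StarWord.x) hy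
  obtain ⟨s, hs⟩ := UniversalContractionAlgebra.exists_lift hy1
  have : q.comp s = StarAlgHom.id ℂ UniversalContractionAlgebra :=
    UniversalContractionAlgebra.algHom_ext (by simp [hs, hqy])
  exact .of_retract s q fun a => DFunLike.congr_fun this a

/-- A *-homomorphism from the universal C⋆-algebra of a contraction has its range in the
commutant of a *-closed set as soon as the image of the contraction belongs to it. -/
lemma UniversalContractionAlgebra.commute_of_commute {B : Type v} [CStarAlgebra B]
    (q : UniversalContractionAlgebra →⋆ₐ[ℂ] B) {y : B} (h : Commute (q (gen StarWord.x)) y)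
    (h' : Commute (q (gen StarWord.x)) (star y)) (a : UniversalContractionAlgebra) :
    Commute (q a) y := by
  refine induction_closed a ?_ (fun m c => ?_) fun a b ha hb => ?_
  · exact isClosed_eq ((map_continuous q).mul continuous_const)
      (continuous_const.mul (map_continuous q))
  · rw [map_smul]
    refine Commute.smul_left ?_ c
    refine StarWord.induction m ?_ h ?_ fun v w hv hw => ?_
    · rw [gen_one, map_one]
      exact Commute.one_left y
    · rw [← star_gen, map_star]
      simpa using h'.star_star
    · rw [gen_mul, map_mul]
      exact hv.mul_left hw
  · rw [map_add]
    exact ha.add_left hb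

/-- The range of `f` is *-closed, hence so is its commutant. This supplies the commutation with
`star y` that the logarithm and the range of `q` require. -/
lemma star_mem_centralizer_range {A : Type u} {B : Type v} [CStarAlgebra A] [CStarAlgebra B]
    (f : A →⋆ₐ[ℂ] B) {y : B} (hy : y ∈ Set.centralizer (Set.range f)) :
    star y ∈ Set.centralizer (Set.range f) := by
  rintro _ ⟨a, rfl⟩
  have := congrArg star (hy (f (star a)) ⟨_, rfl⟩)
  rw [star_mul, star_mul, ← map_star, star_star] at this
  exact this.symm

open Complex ComplexStarModule in
/-- Any two exponential unitaries of a C⋆-algebra are simultaneously images of exponential unitaries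
of the universal C⋆-algebra of a contraction. -/
theorem UniversalContractionAlgebra.exists_map_expUnitary {B : Type} [CStarAlgebra B]
    (h : Fin 2 → selfAdjoint B) :
    ∃ (a : Fin 2 → selfAdjoint UniversalContractionAlgebra)
      (q : UniversalContractionAlgebra →⋆ₐ[ℂ] B),
      (∀ i, q (selfAdjoint.expUnitary (a i)) = selfAdjoint.expUnitary (h i)) ∧
      ∀ y, (∀ i, Commute (h i : B) y) → (∀ i, Commute (h i : B) (star y)) →
        ∀ b, Commute (q b) y := by
  -- The summand `1` keeps `C` invertible when both `h i` vanish.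
  set C : ℝ := ‖h 0‖ + ‖h 1‖ + 1 with hC
  have hC0 : 0 < C := by positivity
  let S : B := h 0 + I • (h 1 : B)
  have hS : ‖S‖ ≤ C := by
    refine (norm_add_le _ _).trans ?_
    rw [norm_smul, norm_I, one_mul, hC]
    exact le_add_of_nonneg_right zero_le_one
  have hT : ‖C⁻¹ • S‖ ≤ 1 := by
    rw [norm_smul, norm_inv, Real.norm_of_nonneg hC0.le]
    exact inv_mul_le_one_of_le₀ hS hC0.le
  obtain ⟨q, hq⟩ := UniversalContractionAlgebra.exists_lift hT
  have hqx : C • q (gen StarWord.x) = S := by rw [hq, smul_inv_smul₀ hC0.ne']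
  have hqx' : q (C • gen StarWord.x) = S := by
    rw [← hqx, ← coe_smul, ← coe_smul, map_smul]
  have hcomm : ∀ y, (∀ i, Commute (h i : B) y) → Commute (q (gen StarWord.x)) y := fun y hy => by
    rw [hq]
    exact ((hy 0).add_left ((hy 1).smul_left I)).smul_left C⁻¹
  have hre : ℜ S = h 0 := by simp [S]
  have him : ℑ S = h 1 := by simp [S]
  refine ⟨![ℜ (C • gen StarWord.x), ℑ (C • gen StarWord.x)], q, fun i => ?_,
    fun y hy hy' => commute_of_commute q (hcomm y hy) (hcomm _ hy')⟩
  let +nondep : NormedAlgebra ℚ UniversalContractionAlgebra := .restrictScalars ℚ ℂ _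
  let +nondep : NormedAlgebra ℚ B := .restrictScalars ℚ ℂ B
  rw [selfAdjoint.expUnitary_coe, selfAdjoint.expUnitary_coe,
    NormedSpace.map_exp q (map_continuous q), map_smul]
  congr 2
  fin_cases i
  · exact (StarAlgHom.map_realPart q _).trans (by rw [hqx', hre]; rfl)
  · exact (StarAlgHom.map_imaginaryPart q _).trans (by rw [hqx', him]; rfl)

open GroupCStarAlgebra in
/-- Every representation of `C*(F₂)` factors through the universal C⋆-algebra of a contraction by
a representation of the latter in the generated von Neumann algebra. -/
theorem GroupCStarAlgebra.exists_factor_universalContraction {H : Type} [NormedAddCommGroup H]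
    [InnerProductSpace ℂ H] [CompleteSpace H]
    (ρ : GroupCStarAlgebra (FreeGroup (Fin 2)) →⋆ₐ[ℂ] (H →L[ℂ] H)) :
    ∃ (ι : GroupCStarAlgebra (FreeGroup (Fin 2)) →⋆ₐ[ℂ] UniversalContractionAlgebra)
      (q : UniversalContractionAlgebra →⋆ₐ[ℂ] (H →L[ℂ] H)),
      (∀ b, q b ∈ Set.centralizer (Set.centralizer (Set.range ρ))) ∧ ∀ a, q (ι a) = ρ a := by
  choose h hexp hcomm using fun i : Fin 2 => exists_selfAdjoint_expUnitary_eq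
    ⟨ρ (unit (G := FreeGroup (Fin 2)) (.of i)), Unitary.map_mem ρ (unit _).2⟩
  obtain ⟨a, q, hqa, hq⟩ := UniversalContractionAlgebra.exists_map_expUnitary h
  obtain ⟨ι, hι⟩ := GroupCStarAlgebra.exists_lift
    (FreeGroup.lift fun i => selfAdjoint.expUnitary (a i))
  have hqι : q.comp ι = ρ := by
    refine algHom_ext_freeGroup fun i => ?_
    change q (ι _) = _
    rw [hι, FreeGroup.lift_apply_of, hqa, hexp]
  refine ⟨ι, q, fun b y hy => ?_, fun b => DFunLike.congr_fun hqι b⟩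
  have hcomm' : ∀ z ∈ Set.centralizer (Set.range ρ), star z ∈ Set.centralizer (Set.range ρ) →
      ∀ i, Commute (h i : H →L[ℂ] H) z := fun z hz hz' i =>
    hcomm i z (hz _ ⟨_, rfl⟩) (hz' _ ⟨_, rfl⟩)
  have hy' := star_mem_centralizer_range ρ hy
  -- The logarithms commute with `y` and `star y`, so every `q b` commutes with `y`.
  exact (hq y (hcomm' y hy hy') (hcomm' _ hy' (by rwa [star_star])) b).symm

theorem embedsRWI_freeGroup_universalContraction :
    EmbedsRWI (GroupCStarAlgebra (FreeGroup (Fin 2))) UniversalContractionAlgebra := by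
  obtain ⟨ι, q, hq, hqι⟩ := GroupCStarAlgebra.exists_factor_universalContraction
    (universalRep (GroupCStarAlgebra (FreeGroup (Fin 2))))
  exact .of_comp_eq ι q hq hqι

end Embeddings

end

theorem theorem5p9 :
    EmbedsRWI UniversalContractionAlgebra (GroupCStarAlgebra (FreeGroup (Fin 2))) ∧
      EmbedsRWI (GroupCStarAlgebra (FreeGroup (Fin 2))) UniversalContractionAlgebra :=
  ⟨embedsRWI_universalContraction_freeGroup, embedsRWI_freeGroup_universalContraction⟩
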